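/- **Setting.** Let $(m_k)_{k\ge1}$ be a strictly increasing sequence of real numbers and $(n_k)_{k\ge1}$, $(l_k)_{k\ge1}$ increasing sequences of natural numbers, the first two strictly, all tending to infinity, with $m_1=n_1=4$, $l_1=2$ and, for all $k\ge2$, $$m_km_{k-1}\le m_1^{l_k},\qquad \Big(\frac{n_{k-1}}{m_{k-1}}\Big)^{l_k}\le\frac{n_k}{m_{k-1}m_k}.$$ For $q\ge1$ let $N_q$ be a finite symmetric $\frac1{4n_q^2}$-net of $[-1,1]$ containing $\pm1$. Define recursively finite sets of nodes $\Delta_q$, $\Gamma_q=\Delta_1\cup\dots\cup\Delta_q$ ($\Gamma_0=\emptyset$), $\Gamma=\bigcup_q\Gamma_q$, and finitely supported functionals $c^*_\gamma$, $d^*_\gamma=e^*_\gamma-c^*_\gamma\in\ell_1(\Gamma)$, where $(e^*_\gamma)_{\gamma\in\Gamma}$ are the unit vectors. Put $\Delta_1=\{1\}$ and $c^*_1=0$; the node $1$ has no weight. Each $\Delta_q$ is enumerated (in an arbitrary fixed way) by $\{\#\Gamma_{q-1}+1,\dots,\#\Gamma_q\}$; intervals of nodes are understood in this enumeration, and $P^*_I$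 denotes the projection onto $\langle d^*_\gamma:\gamma\in I\rangle$ that annihilates $d^*_\gamma$ for $\gamma\notin I$. For $q\geq 1$, $\Delta_{q+1}$ consists of * all tuples $\gamma=(q+1,0,m_j,I,\epsilon,\lambda e^*_\eta)$ with $1\le j\le q$, $I\subset\Gamma_q$ an interval, $\epsilon=\pm1$, $\lambda\in N_q$, $\eta\in\Gamma_q$, $P^*_I(\lambda e^*_\eta)\ne0$; then $c^*_\gamma=\frac{\epsilon}{m_j}P^*_I(\lambda e^*_\eta)$ and $\gamma$ has age $1$; * all tuples $\gamma=(q+1,\xi,m_j,I,\epsilon,\lambda e^*_\eta)$ with $1\le j\le p<q$, $\xi\in\Delta_p$ of weight $m_j^{-1}$ and age less than $n_j$, $I\subset\Gamma_q\setminus\Gamma_p$ an interval, $\epsilon=\pm1$, $\lambda\in N_q$, $\eta\in\Gamma_q\setminus\Gamma_p$, $P^*_I(\lambda e^*_\eta)\ne0$; then $c^*_\gamma=e^*_\xi+\frac{\epsilon}{m_j}P^*_I(\lambda e^*_\eta)$ and the age of $\gamma$ is that of $\xi$ plus $1$. In both cases $\gamma$ has weight $m_j^{-1}$. Let $(d_\gamma)_{\gamma\in\Gamma}\subset\ell_\infty(\Gamma)$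 be the vectors biorthogonal to $(d^*_\gamma)_{\gamma\in\Gamma}$; $e^*_\gamma(x)=x(\gamma)$ for $x\in\ell_\infty(\Gamma)$, and the norm of the space $\overline{\langle d_\gamma:\gamma\in\Gamma\rangle}$ is that of $\ell_\infty(\Gamma)$. Every $\gamma\in\Gamma\setminus\{1\}$ determines the chain $\xi_1,\dots,\xi_a=\gamma$ in which $\xi_1$ is of the first type and $\xi_{i}$ is the second entry of $\xi_{i+1}$ (for $\gamma=1$ the chain is just $1$). Two nodes are *neighbours* if they occur at two different places of one such chain. **Lemma.** Let $j\ge1$, let $(\xi_i)_{i\in G}$ be distinct nodes in $\Gamma$, no two of which are neighbours, with $\#G\le n_j$, and let $x=n_j^{-1}\sum_{i\in G}d_{\xi_i}$. 1. For every $k\ge j$ and every $\gamma\in\Gamma$ of weight $m_k^{-1}$, $|e^*_\gamma(x)|\le\frac1{n_j}+\frac2{m_k}$. 2. Assume in addition, if $j=2$, that $\frac{l_2+1}{n_2}\le\frac{2}{m_1m_2}$. Then $|e^*_\gamma(x)|\le\frac{7}{m_km_j}$ for every $1\le k<j$ and every $\gamma\in\Gamma$ of weight $m_k^{-1}$. In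 particular, $\|x\|\le\frac7{m_j}$. -/

import Mathlib

open scoped ENNReal

noncomputable section

namespace BDSpace

/-- The parameters of the construction. All sequences are indexed by `k ≥ 1`; the values at `0` play
no role. `net q` is the finite set `Net_{1,q}`. -/
structure Params where
  m : ℕ → ℝ
  n : ℕ → ℕ
  l : ℕ → ℕ
  m_one : m 1 = 4
  n_one : n 1 = 4
  l_one : l 1 = 2
  m_strictMono : StrictMonoOn m (Set.Ici 1)
  n_strictMono : StrictMonoOn n (Set.Ici 1)
  l_mono : MonotoneOn l (Set.Ici 1)
  m_tendsto : Filter.Tendsto m Filter.atTop Filter.atTop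
  n_tendsto : Filter.Tendsto n Filter.atTop Filter.atTop
  l_tendsto : Filter.Tendsto l Filter.atTop Filter.atTop
  m_mul_le : ∀ k, 1 ≤ k → m (k + 1) * m k ≤ m 1 ^ l (k + 1)
  ratio_pow_le : ∀ k, 1 ≤ k →
    ((n k : ℝ) / m k) ^ l (k + 1) ≤ (n (k + 1) : ℝ) / (m k * m (k + 1))
  net : ℕ → Finset ℝ
  net_subset : ∀ q, 1 ≤ q → ∀ t ∈ net q, t ∈ Set.Icc (-1 : ℝ) 1
  net_symm : ∀ q, 1 ≤ q → ∀ t ∈ net q, -t ∈ net q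
  one_mem_net : ∀ q, 1 ≤ q → (1 : ℝ) ∈ net q
  net_dense : ∀ q, 1 ≤ q → ∀ t ∈ Set.Icc (-1 : ℝ) 1,
    ∃ s ∈ net q, |t - s| ≤ 1 / (4 * (n q : ℝ) ^ 2)

/-- Formal tuples, from which the nodes are selected below:
* `root` is the only element of `Δ_1`;
* `init q j I ε lam η` is the tuple `(q+1, 0, m_j, I, ε, lam • e*_η)`;
* `succ q ξ j I ε lam η` is the tuple `(q+1, ξ, m_j, I, ε, lam • e*_η)`.

An interval of nodes is recorded as the set `I` of the numbers of its elements in the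
enumeration of the nodes. -/
inductive Node : Type
  | root : Node
  | init (q j : ℕ) (I : Finset ℕ) (ε lam : ℝ) (η : Node) : Node
  | succ (q : ℕ) (ξ : Node) (j : ℕ) (I : Finset ℕ) (ε lam : ℝ) (η : Node) : Node

namespace Node

def rank : Node → ℕ
  | root => 1
  | init q _ _ _ _ _ => q + 1
  | succ q _ _ _ _ _ _ => q + 1

/-- The age of a node (the root, which has no age, gets the value `0`). -/
def age : Node → ℕ
  | root => 0
  | init _ _ _ _ _ _ => 1
  | succ _ ξ _ _ _ _ _ => ξ.age + 1

/-- `γ.weightIndex = some k` means that the weight of `γ` is `1 / m_k`. The root has no weight. -/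
def weightIndex : Node → Option ℕ
  | root => none
  | init _ j _ _ _ _ => some j
  | succ _ _ j _ _ _ _ => some j

/-- The nodes `ξ_1, …, ξ_a = γ` of the evaluation analysis of `γ`, in this order, so that the
bd-part of `e*_γ` is `∑ i, d*_{ξ_i}`. -/
def bdNodes : Node → List Node
  | root => [root]
  | init q j I ε lam η => [init q j I ε lam η]
  | succ q ξ j I ε lam η => ξ.bdNodes ++ [succ q ξ j I ε lam η]

end Node

open Node

section Functionals

variable (S : Params) (idx : Node → ℕ)

open Classical in
/-- `projUnit γ J` is `P*_J e*_γ`, written in the unit vectors `e*_β = Finsupp.single β 1`.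
It is obtained from `e*_γ = d*_γ + c*_γ`, where `P*_J d*_γ` is `d*_γ` or `0` according to whether
the number of `γ` is in `J`, and from `P*_J P*_I = P*_{I ∩ J}`.
See `Pstar_dStar` for the property that characterises it. -/
def projUnit : Node → Finset ℕ → (Node →₀ ℝ)
  | root, J => if idx root ∈ J then Finsupp.single root 1 else 0
  | init q j I ε lam η, J =>
      (if idx (init q j I ε lam η) ∈ J then
          Finsupp.single (init q j I ε lam η) 1 - (ε * lam / S.m j) • projUnit η I
        else 0)
        + (ε * lam / S.m j) • projUnit η (I ∩ J)
  | succ q ξ j I ε lam η, J =>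
      (if idx (succ q ξ j I ε lam η) ∈ J then
          Finsupp.single (succ q ξ j I ε lam η) 1
            - (Finsupp.single ξ 1 + (ε * lam / S.m j) • projUnit η I)
        else 0)
        + (projUnit ξ J + (ε * lam / S.m j) • projUnit η (I ∩ J))

/-- The projection `P*_J` onto the span of the `d*_γ` with number in `J`, along the other ones. -/
def Pstar (J : Finset ℕ) : (Node →₀ ℝ) →ₗ[ℝ] (Node →₀ ℝ) :=
  Finsupp.linearCombination ℝ (fun γ => projUnit S idx γ J)

/-- The functionals `c*_γ`. -/
def cStar : Node → (Node →₀ ℝ)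
  | root => 0
  | init _ j I ε lam η => (1 / S.m j * ε) • Pstar S idx I (lam • Finsupp.single η 1)
  | succ _ ξ j I ε lam η =>
      Finsupp.single ξ 1 + (1 / S.m j * ε) • Pstar S idx I (lam • Finsupp.single η 1)

/-- The functionals `d*_γ = e*_γ - c*_γ`. -/
def dStar (γ : Node) : Node →₀ ℝ := Finsupp.single γ 1 - cStar S idx γ

theorem Pstar_single (J : Finset ℕ) (γ : Node) (t : ℝ) :
    Pstar S idx J (Finsupp.single γ t) = t • projUnit S idx γ J := by
  simp [Pstar]

open Classical in
theorem projUnit_eq (γ : Node) (J : Finset ℕ) :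
    projUnit S idx γ J =
      (if idx γ ∈ J then dStar S idx γ else 0) +
        (match γ with
          | root => 0
          | init _ j I ε lam η => (ε * lam / S.m j) • projUnit S idx η (I ∩ J)
          | succ _ ξ j I ε lam η =>
              projUnit S idx ξ J + (ε * lam / S.m j) • projUnit S idx η (I ∩ J)) := by
  have key : ∀ (j : ℕ) (ε lam : ℝ) (v : Node →₀ ℝ),
      (1 / S.m j * ε) • lam • v = (ε * lam / S.m j) • v := by
    intro j ε lam v
    rw [smul_smul]; congr 1; ring
  cases γ with
  | root => simp [projUnit, dStar, cStar]
  | init q j I ε lam η =>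
    simp only [projUnit, dStar, cStar, map_smul, Pstar_single, one_smul, key]
  | succ q ξ j I ε lam η =>
    simp only [projUnit, dStar, cStar, map_smul, Pstar_single, one_smul, key]

open Classical in
/-- `P*_J` fixes the `d*_γ` with number in `J` and annihilates the other ones. -/
theorem Pstar_dStar (J : Finset ℕ) (γ : Node) :
    Pstar S idx J (dStar S idx γ) = if idx γ ∈ J then dStar S idx γ else 0 := by
  have key : ∀ (j : ℕ) (ε lam : ℝ) (v : Node →₀ ℝ),
      (1 / S.m j * ε) • lam • v = (ε * lam / S.m j) • v := by
    intro j ε lam v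
    rw [smul_smul]; congr 1; ring
  -- the statement for `γ` follows from the composition rule at the components of `γ`
  have main : ∀ γ : Node,
      (∀ J, Pstar S idx J (dStar S idx γ) = if idx γ ∈ J then dStar S idx γ else 0) ∧
      (∀ I J, Pstar S idx J (projUnit S idx γ I) = projUnit S idx γ (I ∩ J)) := by
    intro γ
    induction γ with
    | root =>
      have h1 : ∀ J, Pstar S idx J (dStar S idx root)
          = if idx root ∈ J then dStar S idx root else 0 := by
        intro J
        simp [dStar, cStar, Pstar_single, projUnit]
      refine ⟨h1, fun I J => ?_⟩
      rw [projUnit_eq, projUnit_eq]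
      by_cases hI : idx root ∈ I <;> simp [hI, h1]
    | init q j I₀ ε lam η ih =>
      have h1 : ∀ J, Pstar S idx J (dStar S idx (init q j I₀ ε lam η))
          = if idx (init q j I₀ ε lam η) ∈ J then dStar S idx (init q j I₀ ε lam η) else 0 := by
        intro J
        conv_lhs => rw [dStar, map_sub, Pstar_single, one_smul, projUnit_eq]
        simp only [cStar, map_smul, Pstar_single, one_smul, key, ih.2]
        abel
      refine ⟨h1, fun I J => ?_⟩
      rw [projUnit_eq, projUnit_eq]
      by_cases hI : idx (init q j I₀ ε lam η) ∈ I <;>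
        simp [hI, h1, ih.2, Finset.inter_assoc]
    | succ q ξ j I₀ ε lam η ihξ ih =>
      have h1 : ∀ J, Pstar S idx J (dStar S idx (succ q ξ j I₀ ε lam η))
          = if idx (succ q ξ j I₀ ε lam η) ∈ J then
              dStar S idx (succ q ξ j I₀ ε lam η) else 0 := by
        intro J
        conv_lhs => rw [dStar, map_sub, Pstar_single, one_smul, projUnit_eq]
        simp only [cStar, map_add, map_smul, Pstar_single, one_smul, key, ih.2]
        abel
      refine ⟨h1, fun I J => ?_⟩
      rw [projUnit_eq, projUnit_eq]
      by_cases hI : idx (succ q ξ j I₀ ε lam η) ∈ I <;>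
        simp [hI, h1, ih.2, ihξ.2, Finset.inter_assoc]
  exact (main γ).1 J

/-- The functionals `d*_γ` span all finitely supported functionals. -/
theorem span_dStar : Submodule.span ℝ (Set.range (dStar S idx)) = ⊤ := by
  have hP : ∀ γ : Node, Finsupp.single γ (1 : ℝ) ∈ Submodule.span ℝ (Set.range (dStar S idx)) ∧
      ∀ J, projUnit S idx γ J ∈ Submodule.span ℝ (Set.range (dStar S idx)) := by
    have hd : ∀ γ, dStar S idx γ ∈ Submodule.span ℝ (Set.range (dStar S idx)) :=
      fun γ => Submodule.subset_span ⟨γ, rfl⟩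
    have hite : ∀ γ (J : Finset ℕ), (if idx γ ∈ J then dStar S idx γ else 0)
        ∈ Submodule.span ℝ (Set.range (dStar S idx)) := by
      intro γ J
      split_ifs
      exacts [hd γ, Submodule.zero_mem _]
    have hs : ∀ γ, cStar S idx γ ∈ Submodule.span ℝ (Set.range (dStar S idx)) →
        Finsupp.single γ (1 : ℝ) ∈ Submodule.span ℝ (Set.range (dStar S idx)) := by
      intro γ h
      have := Submodule.add_mem _ (hd γ) h
      simpa [dStar] using this
    intro γ
    induction γ with
    | root =>
      refine ⟨hs _ (by simp [cStar]), fun J => ?_⟩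
      rw [projUnit_eq]
      exact Submodule.add_mem _ (by convert hite root J) (Submodule.zero_mem _)
    | init q j I ε lam η ih =>
      refine ⟨hs _ ?_, fun J => ?_⟩
      · simp only [cStar, map_smul, Pstar_single, one_smul]
        exact Submodule.smul_mem _ _ (Submodule.smul_mem _ _ (ih.2 _))
      · rw [projUnit_eq]
        exact Submodule.add_mem _ (by convert hite _ J) (Submodule.smul_mem _ _ (ih.2 _))
    | succ q ξ j I ε lam η ihξ ih =>
      refine ⟨hs _ ?_, fun J => ?_⟩
      · simp only [cStar, map_smul, Pstar_single, one_smul]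
        exact Submodule.add_mem _ ihξ.1
          (Submodule.smul_mem _ _ (Submodule.smul_mem _ _ (ih.2 _)))
      · rw [projUnit_eq]
        exact Submodule.add_mem _ (by convert hite _ J)
          (Submodule.add_mem _ (ihξ.2 _) (Submodule.smul_mem _ _ (ih.2 _)))
  rw [eq_top_iff]
  intro v _
  induction v using Finsupp.induction_linear with
  | zero => exact Submodule.zero_mem _
  | add f g hf hg => exact Submodule.add_mem _ (hf trivial) (hg trivial)
  | single γ t =>
    have := Submodule.smul_mem _ t (hP γ).1
    simpa using this

open Classical in
/-- The values `d_β(γ) = e*_γ(d_β)` of the vectors biorthogonal to the functionals `d*_γ`.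
See `pairing_dStar` for the biorthogonality, which determines them by `span_dStar`. -/
def dVal (β : Node) : Node → ℝ
  | root => if root = β then 1 else 0
  | init q j I ε lam η =>
      (if init q j I ε lam η = β then 1 else 0)
        + ε * lam / S.m j * (if idx β ∈ I then dVal β η else 0)
  | succ q ξ j I ε lam η =>
      (if succ q ξ j I ε lam η = β then 1 else 0)
        + (dVal β ξ + ε * lam / S.m j * (if idx β ∈ I then dVal β η else 0))

open Classical in
/-- Biorthogonality: `d*_γ(d_β)` is `1` if `γ = β` and `0` otherwise. -/
theorem pairing_dStar (β γ : Node) :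
    Finsupp.linearCombination ℝ (dVal S idx β) (dStar S idx γ) = if γ = β then 1 else 0 := by
  have key : ∀ (j : ℕ) (ε lam t : ℝ), 1 / S.m j * ε * (lam * t) = ε * lam / S.m j * t := by
    intros; ring
  have main : ∀ γ : Node,
      Finsupp.linearCombination ℝ (dVal S idx β) (dStar S idx γ) = (if γ = β then 1 else 0) ∧
      ∀ J, Finsupp.linearCombination ℝ (dVal S idx β) (projUnit S idx γ J)
        = if idx β ∈ J then dVal S idx β γ else 0 := by
    intro γ
    induction γ with
    | root =>
      have h1 : Finsupp.linearCombination ℝ (dVal S idx β) (dStar S idx root)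
          = if root = β then 1 else 0 := by
        simp [dStar, cStar, dVal]
      refine ⟨h1, fun J => ?_⟩
      rw [projUnit_eq]
      by_cases hb : root = β
      · subst hb
        by_cases hJ : idx root ∈ J <;> simp [hJ, h1, dVal]
      · by_cases hJ : idx root ∈ J <;> simp [hJ, h1, dVal, hb]
    | init q j I ε lam η ih =>
      have h1 : Finsupp.linearCombination ℝ (dVal S idx β) (dStar S idx (init q j I ε lam η))
          = if init q j I ε lam η = β then 1 else 0 := by
        simp only [dStar, cStar, map_sub, map_smul, Pstar_single, one_smul, smul_eq_mul, ih.2,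
          Finsupp.linearCombination_single, dVal, key]
        ring
      refine ⟨h1, fun J => ?_⟩
      rw [projUnit_eq]
      by_cases hb : init q j I ε lam η = β
      · subst hb
        by_cases hJ : idx (init q j I ε lam η) ∈ J <;>
          simp [hJ, h1, dVal, ih.2, Finset.mem_inter]
      · by_cases hJ : idx β ∈ J <;> by_cases hJ' : idx (init q j I ε lam η) ∈ J <;>
          simp [hJ, hJ', h1, dVal, hb, ih.2, Finset.mem_inter]
    | succ q ξ j I ε lam η ihξ ih =>
      have h1 : Finsupp.linearCombination ℝ (dVal S idx β) (dStar S idx (succ q ξ j I ε lam η))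
          = if succ q ξ j I ε lam η = β then 1 else 0 := by
        simp only [dStar, cStar, map_sub, map_add, map_smul, Pstar_single, one_smul, smul_eq_mul,
          ih.2, Finsupp.linearCombination_single, dVal, key]
        ring
      refine ⟨h1, fun J => ?_⟩
      rw [projUnit_eq]
      by_cases hb : succ q ξ j I ε lam η = β
      · subst hb
        by_cases hJ : idx (succ q ξ j I ε lam η) ∈ J <;>
          simp [hJ, h1, dVal, ih.2, ihξ.2, Finset.mem_inter]
      · by_cases hJ : idx β ∈ J <;> by_cases hJ' : idx (succ q ξ j I ε lam η) ∈ J <;>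
          simp [hJ, hJ', h1, dVal, hb, ih.2, ihξ.2, Finset.mem_inter]
  exact (main γ).1

/-- The sets `Γ_q = Δ_1 ∪ … ∪ Δ_q`. In the step from `q` to `q + 1` (here `q ≥ 1`), the set `Γ_p`
with `p ≤ q` consists of the elements of `Γ_q` of rank at most `p`, and `Δ_p` of those of
rank `p`. -/
def Gam : ℕ → Set Node
  | 0 => ∅
  | 1 => {root}
  | q + 2 => Gam (q + 1) ∪
      ({γ | ∃ (j : ℕ) (I : Finset ℕ) (ε lam : ℝ) (η : Node),
          γ = init (q + 1) j I ε lam η ∧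
          1 ≤ j ∧ j ≤ q + 1 ∧
          (∃ a b : ℕ, I = Finset.Icc a b) ∧
          (I : Set ℕ) ⊆ idx '' Gam (q + 1) ∧
          (ε = 1 ∨ ε = -1) ∧
          lam ∈ S.net (q + 1) ∧ η ∈ Gam (q + 1) ∧
          Pstar S idx I (lam • Finsupp.single η 1) ≠ 0} ∪
       {γ | ∃ (p : ℕ) (ξ : Node) (j : ℕ) (I : Finset ℕ) (ε lam : ℝ) (η : Node),
          γ = succ (q + 1) ξ j I ε lam η ∧
          1 ≤ p ∧ p < q + 1 ∧
          1 ≤ j ∧ j ≤ p ∧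
          ξ ∈ Gam (q + 1) ∧ ξ.rank = p ∧ ξ.weightIndex = some j ∧ ξ.age < S.n j ∧
          (∃ a b : ℕ, I = Finset.Icc a b) ∧
          (I : Set ℕ) ⊆ idx '' {β ∈ Gam (q + 1) | p < β.rank} ∧
          (ε = 1 ∨ ε = -1) ∧
          lam ∈ S.net (q + 1) ∧ η ∈ Gam (q + 1) ∧ p < η.rank ∧
          Pstar S idx I (lam • Finsupp.single η 1) ≠ 0})

end Functionals

/-- An enumeration of the nodes: `Δ_{q+1} = Γ_{q+1} \ Γ_q` is enumerated by
`{#Γ_q + 1, …, #Γ_{q+1}}`. (Membership in `Γ_{q+1}` only involves the numbers of the elements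
of `Γ_q`.) -/
structure Enumeration (S : Params) where
  idx : Node → ℕ
  bijOn : ∀ q, Set.BijOn idx (Gam S idx (q + 1) \ Gam S idx q)
    (Set.Ioc (Gam S idx q).ncard (Gam S idx (q + 1)).ncard)

namespace Enumeration

variable {S : Params} (E : Enumeration S)

/-- The set `Γ = ⋃ q, Γ_q` of all nodes. -/
def nodes : Set Node := ⋃ q, Gam S E.idx q

/-- Two nodes are neighbours if they occur at different places of one bd-part. -/
def Neighbours (ξ₁ ξ₂ : E.nodes) : Prop :=
  ∃ γ ∈ E.nodes, ∃ j₁ j₂ : ℕ, j₁ < j₂ ∧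
    γ.bdNodes[j₁]? = some ξ₁.1 ∧ γ.bdNodes[j₂]? = some ξ₂.1

theorem gam_mono : Monotone (Gam S E.idx) := by
  apply monotone_nat_of_le_succ
  intro q
  cases q with
  | zero => simp [Gam]
  | succ q =>
    conv_rhs => rw [Gam]
    exact Set.subset_union_left

theorem rank_of_mem (q : ℕ) : ∀ γ ∈ Gam S E.idx q, γ.rank ≤ q ∧ γ ∈ Gam S E.idx γ.rank := by
  induction q with
  | zero => simp [Gam]
  | succ q ih =>
    cases q with
    | zero =>
      intro γ hγ
      have : γ = root := by simpa [Gam] using hγ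
      subst this
      simp [rank, Gam]
    | succ q =>
      intro γ hγ
      have hγ' := hγ
      rw [Gam] at hγ
      rcases hγ with h | ⟨j, I, ε, lam, η, rfl, h⟩ | ⟨p, ξ, j, I, ε, lam, η, rfl, h⟩
      · exact ⟨(ih γ h).1.trans (Nat.le_succ _), (ih γ h).2⟩
      · exact ⟨le_rfl, hγ'⟩
      · exact ⟨le_rfl, hγ'⟩

theorem idx_injOn : Set.InjOn E.idx E.nodes := by
  have hex : ∀ γ ∈ E.nodes, ∃ q, γ ∈ Gam S E.idx (q + 1) \ Gam S E.idx q := by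
    intro γ hγ
    obtain ⟨q, hq⟩ := Set.mem_iUnion.1 hγ
    classical
    have h : ∃ q, γ ∈ Gam S E.idx q := ⟨q, hq⟩
    have h0 : Nat.find h ≠ 0 := by
      intro h0
      have := Nat.find_spec h
      rw [h0] at this
      simp [Gam] at this
    obtain ⟨r, hr⟩ := Nat.exists_eq_succ_of_ne_zero h0
    refine ⟨r, ?_, Nat.find_min h (by omega)⟩
    have := Nat.find_spec h
    rwa [hr] at this
  intro γ hγ β hβ heq
  obtain ⟨q, hq⟩ := hex γ hγ
  obtain ⟨r, hr⟩ := hex β hβ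
  have hfin : ∀ q, (Gam S E.idx q).Finite := by
    intro q
    induction q with
    | zero => simp [Gam]
    | succ q ih =>
      have h1 : (Gam S E.idx (q + 1) \ Gam S E.idx q).Finite :=
        Set.Finite.of_finite_image ((Set.finite_Ioc _ _).subset (E.bijOn q).mapsTo.image_subset)
          (E.bijOn q).injOn
      exact (h1.union ih).subset (by intro x hx; by_cases h : x ∈ Gam S E.idx q <;> simp [h, hx])
  have hmono : Monotone fun q => (Gam S E.idx q).ncard :=
    fun a b hab => Set.ncard_le_ncard (E.gam_mono hab) (hfin b)
  have h1 := Set.mem_Ioc.1 ((E.bijOn q).mapsTo hq)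
  have h2 := Set.mem_Ioc.1 ((E.bijOn r).mapsTo hr)
  rcases lt_trichotomy q r with h | h | h
  · have := hmono (show q + 1 ≤ r from h)
    simp only at this
    omega
  · subst h
    exact (E.bijOn q).injOn hq hr heq
  · have := hmono (show r + 1 ≤ q from h)
    simp only at this
    omega

open Classical in
/-- The vectors `d_β` are bounded by `2`. -/
theorem abs_dVal_le (β : Node) (hβ : β ∈ E.nodes) (γ : Node) (hγ : γ ∈ E.nodes) :
    |dVal S E.idx β γ| ≤ 2 := by
  have hm : ∀ j, 1 ≤ j → 4 ≤ S.m j := by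
    intro j hj
    rw [← S.m_one]
    exact S.m_strictMono.monotoneOn (by simp) (by simpa using hj) hj
  have hcoef : ∀ q j (ε lam t : ℝ), 1 ≤ q → 1 ≤ j → (ε = 1 ∨ ε = -1) → lam ∈ S.net q → |t| ≤ 2 →
      |ε * lam / S.m j * t| ≤ 1 / 2 := by
    intro q j ε lam t hq hj hε hl ht
    have h1 : |lam| ≤ 1 := abs_le.2 (S.net_subset q hq lam hl)
    have h2 : |ε| = 1 := by rcases hε with rfl | rfl <;> simp
    have h3 := hm j hj
    rw [abs_mul, abs_div, abs_mul, h2, one_mul, abs_of_pos (by linarith : 0 < S.m j),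
      div_mul_eq_mul_div, div_le_iff₀ (by linarith)]
    nlinarith [abs_nonneg lam, abs_nonneg t]
  have main : ∀ q, ∀ γ ∈ Gam S E.idx q, |dVal S E.idx β γ| ≤ 2 ∧
      (q < β.rank → dVal S E.idx β γ = 0) := by
    intro q
    induction q using Nat.strong_induction_on with
    | _ q ih =>
      intro γ hγ
      match q, hγ with
      | 0, hγ => simp [Gam] at hγ
      | 1, hγ =>
        have : γ = root := by simpa [Gam] using hγ
        subst this
        refine ⟨?_, fun h => ?_⟩
        · simp only [dVal]; split_ifs <;> norm_num
        · have : root ≠ β := by rintro rfl; simp [rank] at h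
          simp [dVal, this]
      | q + 2, hγ =>
        have hrank : ∀ i ∈ E.idx '' Gam S E.idx (q + 1), E.idx β = i → β.rank ≤ q + 1 := by
          rintro _ ⟨δ, hδ, rfl⟩ h
          have := E.idx_injOn hβ (Set.mem_iUnion.2 ⟨_, hδ⟩) h
          subst this
          exact (E.rank_of_mem _ _ hδ).1
        rw [Gam] at hγ
        rcases hγ with h | ⟨j, I, ε, lam, η, rfl, hj1, -, -, hI, hε, hl, hη, -⟩ |
          ⟨p, ξ, j, I, ε, lam, η, rfl, hp, hpq, hj1, -, hξ, hξp, -, -, -, hI, hε, hl, hη, -, -⟩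
        · have := ih (q + 1) (by omega) γ h
          exact ⟨this.1, fun h => this.2 (by omega)⟩
        · have hη' := ih (q + 1) (by omega) η hη
          refine ⟨?_, fun h => ?_⟩
          · have hb : |(if E.idx β ∈ I then dVal S E.idx β η else 0)| ≤ 2 := by
              split_ifs
              exacts [hη'.1, by norm_num]
            have h1 := hcoef (q + 1) j ε lam _ (by omega) hj1 hε hl hb
            simp only [dVal]
            refine (abs_add_le _ _).trans ?_
            have h2 : |(if init (q + 1) j I ε lam η = β then (1 : ℝ) else 0)| ≤ 1 := by
              split_ifs <;> norm_num
            linarith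
          · have h1 : init (q + 1) j I ε lam η ≠ β := by rintro rfl; simp [rank] at h
            have h2 : E.idx β ∉ I := fun hc => by
              have := hrank _ (hI hc) rfl
              omega
            simp [dVal, h1, h2]
        · have hη' := ih (q + 1) (by omega) η hη
          have hξ' := ih p (by omega) ξ (by
            have := (E.rank_of_mem _ _ hξ).2
            rwa [hξp] at this)
          have hb : |(if E.idx β ∈ I then dVal S E.idx β η else 0)| ≤ 2 := by
            split_ifs
            exacts [hη'.1, by norm_num]
          have h1 := hcoef (q + 1) j ε lam _ (by omega) hj1 hε hl hb
          refine ⟨?_, fun h => ?_⟩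
          · by_cases hr : β.rank ≤ p
            · have h2 : E.idx β ∉ I := fun hc => by
                obtain ⟨δ, hδ, hδe⟩ := hI hc
                have := E.idx_injOn hβ (Set.mem_iUnion.2 ⟨_, hδ.1⟩) hδe.symm
                subst this
                exact absurd hδ.2 (by omega)
              have h3 : succ (q + 1) ξ j I ε lam η ≠ β := by
                rintro rfl; simp [rank] at hr; omega
              simpa [dVal, h2, h3] using hξ'.1
            · have h3 := hξ'.2 (by omega)
              simp only [dVal, h3, zero_add]
              refine (abs_add_le _ _).trans ?_
              have h2 : |(if succ (q + 1) ξ j I ε lam η = β then (1 : ℝ) else 0)| ≤ 1 := by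
                split_ifs <;> norm_num
              linarith
          · have h1 : succ (q + 1) ξ j I ε lam η ≠ β := by rintro rfl; simp [rank] at h
            have h2 : E.idx β ∉ I := fun hc => by
              obtain ⟨δ, hδ, hδe⟩ := hI hc
              have := hrank _ ⟨δ, hδ.1, hδe⟩ rfl
              omega
            have h3 := hξ'.2 (by omega)
            simp [dVal, h1, h2, h3]
  obtain ⟨q, hq⟩ := Set.mem_iUnion.1 hγ
  exact (main q γ hq).1

/-- The basis vectors `d_β ∈ ℓ_∞(Γ)`. The space under consideration is their closed span, with
the norm of `ℓ_∞(Γ)`, and `e*_γ(x)` is the coordinate `x γ`. -/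
def d (β : E.nodes) : lp (fun _ : E.nodes => ℝ) ∞ :=
  ⟨fun γ => dVal S E.idx β γ, memℓp_infty ⟨2, by
    rintro _ ⟨γ, rfl⟩
    exact E.abs_dVal_le β β.2 γ γ.2⟩⟩

end Enumeration

end BDSpace

end

/-!
Up to the factor `1 / n_j`, the quantity to estimate is `∑ β ∈ A, d_β(γ)` with `A = F`. The
evaluation analysis of a node `γ` of weight `1 / m_k` writes `e*_γ` as a sum of at most `n_k`
functionals `d*_{ξ_r}` (the bd-part) plus `1 / m_k` times a sum of at most `n_k` functionals
`± λ_r • P*_{I_r} e*_{η_r}` with pairwise disjoint intervals `I_r` and `|λ_r| ≤ 1`. Since no two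
elements of `A` are neighbours, the bd-part contributes at most `1`. Hence, if
`|∑ β ∈ B, d_β(η)| ≤ C + c * #B` for all nodes `η` and all `B ⊆ A`, then
`|∑ β ∈ A, d_β(γ)| ≤ 1 + (n_k * C + c * #A) / m_k`: this is `abs_sum_dVal_le`. The disjointness of
the intervals is what makes the terms `c * #B` add up to at most `c * #A`.

For `k ≥ j` the trivial bound `C = 0`, `c = 2` suffices. For `k < j` the inequality is iterated
along the tree of the successive evaluation analyses (`abs_sum_dVal_le_of_depth`). With
`R = n_{j-1} / m_{j-1}`, which bounds all `n_k / m_k` with `k < j`, the bd-parts met down to depth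
`L` contribute at most `∑ s ≤ L, R ^ s`. A branch stops when it meets a weight of index at least
`j`, which gains the factor `1 / m_j`, and a branch that meets none has gained `4 ^ (-L)` at
depth `L`. The choice `L = l_j - 1` balances the two: `4 ^ (-l_j) ≤ 1 / (m_{j-1} * m_j)` by the first
growth condition, while the geometric sum is at most `2 * n_j / (m_{j-1} * m_j)`, by the second
growth condition if `j ≥ 3`, where `R ≥ 4`, and by the additional hypothesis if `j = 2`, where
`R = 1`.
-/

namespace BDSpace

/-! ### The parameters -/

namespace Params

variable (S : Params)

theorem m_mono {i k : ℕ} (hi : 1 ≤ i) (hik : i ≤ k) : S.m i ≤ S.m k :=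
  S.m_strictMono.monotoneOn (Set.mem_Ici.2 hi) (Set.mem_Ici.2 (hi.trans hik)) hik

theorem four_le_m {k : ℕ} (hk : 1 ≤ k) : 4 ≤ S.m k :=
  S.m_one ▸ S.m_mono le_rfl hk

theorem four_le_n {k : ℕ} (hk : 1 ≤ k) : 4 ≤ S.n k :=
  S.n_one ▸ S.n_strictMono.monotoneOn (Set.mem_Ici.2 le_rfl) (Set.mem_Ici.2 hk) hk

theorem two_le_l {k : ℕ} (hk : 1 ≤ k) : 2 ≤ S.l k :=
  S.l_one ▸ S.l_mono (Set.mem_Ici.2 le_rfl) (Set.mem_Ici.2 hk) hk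

theorem four_mul_ratio_le {k : ℕ} (hk : 1 ≤ k) (h1 : 1 ≤ (S.n k : ℝ) / S.m k) :
    4 * ((S.n k : ℝ) / S.m k) ≤ (S.n (k + 1) : ℝ) / S.m (k + 1) := by
  have hm := S.four_le_m hk
  have hm' := S.four_le_m (k := k + 1) (by omega)
  have hl := S.two_le_l (k := k + 1) (by omega)
  have hpow : (S.n k : ℝ) / S.m k ≤ ((S.n k : ℝ) / S.m k) ^ S.l (k + 1) :=
    le_self_pow₀ h1 (by omega)
  calc 4 * ((S.n k : ℝ) / S.m k)
      ≤ S.m k * ((S.n (k + 1) : ℝ) / (S.m k * S.m (k + 1))) :=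
        mul_le_mul hm (hpow.trans (S.ratio_pow_le k hk)) (by linarith) (by linarith)
    _ = (S.n (k + 1) : ℝ) / S.m (k + 1) := by field_simp

theorem one_le_ratio {k : ℕ} (hk : 1 ≤ k) : 1 ≤ (S.n k : ℝ) / S.m k := by
  induction k, hk using Nat.le_induction with
  | base => simp [S.m_one, S.n_one]
  | succ k hk ih => linarith [S.four_mul_ratio_le hk ih]

theorem ratio_mono {i k : ℕ} (hi : 1 ≤ i) (hik : i ≤ k) :
    (S.n i : ℝ) / S.m i ≤ (S.n k : ℝ) / S.m k := by
  induction k, hik using Nat.le_induction with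
  | base => exact le_rfl
  | succ k hk ih =>
    have h1 := S.one_le_ratio (hi.trans hk)
    linarith [S.four_mul_ratio_le (hi.trans hk) h1]

theorem m_le_n {k : ℕ} (hk : 1 ≤ k) : S.m k ≤ S.n k := by
  have hm := S.four_le_m hk
  exact (one_le_div (by linarith)).1 (S.one_le_ratio hk)

end Params

theorem geom_sum_le_two_mul_pow {R : ℝ} (hR : 4 ≤ R) (L : ℕ) :
    ∑ s ∈ Finset.range (L + 1), R ^ s ≤ 2 * R ^ L := by
  induction L with
  | zero => simp
  | succ L ih =>
    rw [Finset.sum_range_succ]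
    have hpow : 0 ≤ R ^ L := by positivity
    rw [pow_succ]
    nlinarith

/-- The bd-parts met down to depth `l_{i+1}` have total weight at most
`2 n_{i+1} / (m_i m_{i+1})`. -/
theorem Params.geom_sum_ratio_le (S : Params) {i : ℕ} (hi : 1 ≤ i)
    (h2 : i = 1 → ((S.l 2 : ℝ) + 1) / (S.n 2 : ℝ) ≤ 2 / (S.m 1 * S.m 2)) :
    ∑ s ∈ Finset.range (S.l (i + 1) + 1), ((S.n i : ℝ) / S.m i) ^ s
      ≤ 2 * ((S.n (i + 1) : ℝ) / (S.m i * S.m (i + 1))) := by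
  rcases hi.eq_or_lt with rfl | hi'
  · have hn : (0 : ℝ) < S.n 2 := by
      have := S.four_le_n (k := 2) (by norm_num)
      positivity
    have h := h2 rfl
    rw [div_le_iff₀ hn] at h
    -- here the ratio is `1`
    have hR : (S.n 1 : ℝ) / S.m 1 = 1 := by simp [S.n_one, S.m_one]
    simp only [hR, one_pow, Finset.sum_const, Finset.card_range, nsmul_eq_mul, mul_one]
    push_cast
    refine h.trans (le_of_eq ?_)
    ring
  · obtain ⟨i, rfl⟩ : ∃ k, i = k + 1 := ⟨i - 1, by omega⟩
    have h1 := S.one_le_ratio (k := i) (by omega)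
    have h4 := S.four_mul_ratio_le (by omega) h1
    refine (geom_sum_le_two_mul_pow (by linarith) _).trans ?_
    exact mul_le_mul_of_nonneg_left (S.ratio_pow_le _ hi) zero_le_two

namespace Enumeration

open Node

variable {S : Params} (E : Enumeration S)

/-! ### The structure of nodes -/

/-- The interval `I` has numbers of nodes of rank at most `q` only. -/
theorem rank_le_of_idx_mem {q : ℕ} {I : Finset ℕ} (hI : (I : Set ℕ) ⊆ E.idx '' Gam S E.idx q)
    (β : E.nodes) (hβ : E.idx β ∈ I) : β.1.rank ≤ q := by
  obtain ⟨δ, hδ, h⟩ := hI hβ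
  have := E.idx_injOn (Set.mem_iUnion.2 ⟨_, hδ⟩) β.2 h
  exact this ▸ (E.rank_of_mem _ _ hδ).1

theorem rank_mem_Ioc_of_idx_mem {p q : ℕ} {I : Finset ℕ}
    (hI : (I : Set ℕ) ⊆ E.idx '' {β ∈ Gam S E.idx q | p < β.rank})
    (β : E.nodes) (hβ : E.idx β ∈ I) : p < β.1.rank ∧ β.1.rank ≤ q := by
  obtain ⟨δ, hδ, h⟩ := hI hβ
  have := E.idx_injOn (Set.mem_iUnion.2 ⟨_, hδ.1⟩) β.2 h
  exact this ▸ ⟨hδ.2, (E.rank_of_mem _ _ hδ.1).1⟩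

theorem abs_coef_le {q j : ℕ} {ε lam : ℝ} (hq : 1 ≤ q) (hj : 1 ≤ j) (hε : ε = 1 ∨ ε = -1)
    (hlam : lam ∈ S.net q) : |ε * lam / S.m j| ≤ 1 / S.m j := by
  have h1 : |lam| ≤ 1 := abs_le.2 (S.net_subset q hq lam hlam)
  have h2 : |ε| = 1 := by rcases hε with rfl | rfl <;> simp
  have h3 : 0 < S.m j := by linarith [S.four_le_m hj]
  rw [abs_div, abs_mul, h2, one_mul, abs_of_pos h3]
  gcongr

theorem init_mem_nodes {q j : ℕ} {I : Finset ℕ} {ε lam : ℝ} {η : Node}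
    (h : init q j I ε lam η ∈ E.nodes) :
    1 ≤ j ∧ η ∈ E.nodes ∧ |ε * lam / S.m j| ≤ 1 / S.m j ∧
      ∀ β : E.nodes, E.idx β ∈ I → β.1.rank ≤ q := by
  obtain ⟨r, hr⟩ := Set.mem_iUnion.1 h
  have hG := (E.rank_of_mem r _ hr).2
  rw [rank] at hG
  cases q with
  | zero => simp [Gam] at hG
  | succ q =>
    rw [Gam] at hG
    rcases hG with hG | ⟨j', I', ε', lam', η', heq, hj1, -, -, hI, hε, hl, hη, -⟩ |
      ⟨p, ξ, j', I', ε', lam', η', heq, -⟩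
    · have := (E.rank_of_mem _ _ hG).1
      simp [rank] at this
    · cases heq
      exact ⟨hj1, Set.mem_iUnion.2 ⟨_, hη⟩, abs_coef_le (by omega) hj1 hε hl,
        E.rank_le_of_idx_mem hI⟩
    · cases heq

theorem succ_mem_nodes {q j : ℕ} {ξ : Node} {I : Finset ℕ} {ε lam : ℝ} {η : Node}
    (h : succ q ξ j I ε lam η ∈ E.nodes) :
    1 ≤ j ∧ ξ ∈ E.nodes ∧ η ∈ E.nodes ∧ |ε * lam / S.m j| ≤ 1 / S.m j ∧
      ξ.weightIndex = some j ∧ ξ.age < S.n j ∧ ξ.rank ≤ q ∧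
      ∀ β : E.nodes, E.idx β ∈ I → ξ.rank < β.1.rank ∧ β.1.rank ≤ q := by
  obtain ⟨r, hr⟩ := Set.mem_iUnion.1 h
  have hG := (E.rank_of_mem r _ hr).2
  rw [rank] at hG
  cases q with
  | zero => simp [Gam] at hG
  | succ q =>
    rw [Gam] at hG
    rcases hG with hG | ⟨j', I', ε', lam', η', heq, -⟩ |
      ⟨p, ξ', j', I', ε', lam', η', heq, hp, hpq, hj1, -, hξ, hξp, hw, hage, -, hI, hε, hl, hη,
        -, -⟩
    · have := (E.rank_of_mem _ _ hG).1
      simp [rank] at this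
    · cases heq
    · cases heq
      subst hξp
      exact ⟨hj1, Set.mem_iUnion.2 ⟨_, hξ⟩, Set.mem_iUnion.2 ⟨_, hη⟩,
        abs_coef_le (by omega) hj1 hε hl, hw, hage, by omega, E.rank_mem_Ioc_of_idx_mem hI⟩

theorem one_le_weightIndex {γ : Node} (hγ : γ ∈ E.nodes) {k : ℕ} (hk : γ.weightIndex = some k) :
    1 ≤ k := by
  cases γ with
  | root => simp [weightIndex] at hk
  | init q j I ε lam η =>
    obtain rfl : j = k := by simpa [weightIndex] using hk
    exact (E.init_mem_nodes hγ).1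
  | succ q ξ j I ε lam η =>
    obtain rfl : j = k := by simpa [weightIndex] using hk
    exact (E.succ_mem_nodes hγ).1

theorem age_le {γ : Node} (hγ : γ ∈ E.nodes) {k : ℕ} (hk : γ.weightIndex = some k) :
    γ.age ≤ S.n k := by
  cases γ with
  | root => simp [weightIndex] at hk
  | init q j I ε lam η =>
    obtain rfl : j = k := by simpa [weightIndex] using hk
    have := S.four_le_n (E.init_mem_nodes hγ).1
    simp only [age]
    omega
  | succ q ξ j I ε lam η =>
    obtain rfl : j = k := by simpa [weightIndex] using hk
    exact (E.succ_mem_nodes hγ).2.2.2.2.2.1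

theorem sizeOf_le_of_mem_bdNodes {β γ : Node} (h : β ∈ γ.bdNodes) : sizeOf β ≤ sizeOf γ := by
  induction γ with
  | root => simp_all [bdNodes]
  | init q j I ε lam η => simp_all [bdNodes]
  | succ q ξ j I ε lam η ihξ =>
    simp only [bdNodes, List.mem_append, List.mem_singleton] at h
    rcases h with h | rfl
    · have := ihξ h
      simp only [succ.sizeOf_spec]
      omega
    · exact le_rfl

theorem succ_notMem_bdNodes (q : ℕ) (ξ : Node) (j : ℕ) (I : Finset ℕ) (ε lam : ℝ) (η : Node) :
    succ q ξ j I ε lam η ∉ ξ.bdNodes := by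
  intro h
  have := sizeOf_le_of_mem_bdNodes h
  simp only [succ.sizeOf_spec] at this
  omega

open Classical in
theorem card_filter_bdNodes_le_one {A : Finset E.nodes}
    (hA : ∀ ξ ∈ A, ∀ ζ ∈ A, ξ ≠ ζ → ¬ E.Neighbours ξ ζ) {γ : Node} (hγ : γ ∈ E.nodes) :
    (A.filter fun β => β.1 ∈ γ.bdNodes).card ≤ 1 := by
  rw [Finset.card_le_one]
  intro a ha b hb
  rw [Finset.mem_filter] at ha hb
  obtain ⟨s, hs⟩ := List.mem_iff_getElem?.1 ha.2
  obtain ⟨t, ht⟩ := List.mem_iff_getElem?.1 hb.2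
  by_contra hab
  rcases lt_trichotomy s t with h | h | h
  · exact hA a ha.1 b hb.1 hab ⟨γ, hγ, s, t, h, hs, ht⟩
  · subst h
    rw [hs] at ht
    exact hab (Subtype.ext (Option.some.inj ht))
  · exact hA b hb.1 a ha.1 (Ne.symm hab) ⟨γ, hγ, t, s, h, ht, hs⟩

/-! ### One step of the evaluation analysis -/

open Classical in
theorem sum_dVal_init (A : Finset E.nodes) (q j : ℕ) (I : Finset ℕ) (ε lam : ℝ) (η : Node) :
    ∑ β ∈ A, dVal S E.idx β (init q j I ε lam η)
      = ((A.filter fun β => β.1 = init q j I ε lam η).card : ℝ)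
        + ε * lam / S.m j * ∑ β ∈ A.filter (fun β : E.nodes => E.idx β ∈ I), dVal S E.idx β η := by
  simp only [dVal, Finset.sum_add_distrib, ← Finset.mul_sum, Finset.sum_filter, Finset.card_filter,
    eq_comm]
  push_cast
  rfl

open Classical in
theorem sum_dVal_succ (A : Finset E.nodes) (q : ℕ) (ξ : Node) (j : ℕ) (I : Finset ℕ)
    (ε lam : ℝ) (η : Node) :
    ∑ β ∈ A, dVal S E.idx β (succ q ξ j I ε lam η)
      = ((A.filter fun β => β.1 = succ q ξ j I ε lam η).card : ℝ)
        + (∑ β ∈ A, dVal S E.idx β ξ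
          + ε * lam / S.m j * ∑ β ∈ A.filter (fun β : E.nodes => E.idx β ∈ I), dVal S E.idx β η) := by
  simp only [dVal, Finset.sum_add_distrib, ← Finset.mul_sum, Finset.sum_filter, Finset.card_filter,
    eq_comm]
  push_cast
  rfl

open Classical in
/-- The estimate of the evaluation analysis of `γ`, in a form that passes from `ξ_r` to `ξ_{r+1}`.
The intervals of `ξ_1, …, ξ_r` contain only nodes of rank less than that of `ξ_r`, and the interval
of `ξ_{r+1}` only nodes of larger rank, so the numbers of elements of `A` in the intervals add up to
at most the number of elements of rank less than that of `γ`. -/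
theorem abs_sum_dVal_le_bdNodes {A : Finset E.nodes} {C c : ℝ} (hc : 0 ≤ c)
    (h : ∀ η ∈ E.nodes, ∀ B ⊆ A, |∑ β ∈ B, dVal S E.idx β η| ≤ C + c * B.card)
    (γ : Node) (hγ : γ ∈ E.nodes) {k : ℕ} (hk : γ.weightIndex = some k) :
    |∑ β ∈ A, dVal S E.idx β γ| ≤ ((A.filter fun β => β.1 ∈ γ.bdNodes).card : ℝ)
      + 1 / S.m k * (γ.age * C + c * (A.filter fun β => β.1.rank < γ.rank).card) := by
  induction γ with
  | root => simp [weightIndex] at hk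
  | init q j I ε lam η =>
    obtain rfl : j = k := by simpa [weightIndex] using hk
    obtain ⟨hj, hη, hcoef, hI⟩ := E.init_mem_nodes hγ
    have hm : 0 < S.m j := by linarith [S.four_le_m hj]
    have hsub : A.filter (fun β : E.nodes => E.idx β ∈ I) ⊆ A.filter (fun β => β.1.rank < q + 1) :=
      Finset.monotone_filter_right _ fun β _ hβ => Nat.lt_succ_of_le (hI β hβ)
    have hcard : ((A.filter fun β : E.nodes => E.idx β ∈ I).card : ℝ)
        ≤ (A.filter fun β => β.1.rank < q + 1).card := by
      exact_mod_cast Finset.card_le_card hsub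
    rw [sum_dVal_init]
    refine (abs_add_le _ _).trans ?_
    rw [Nat.abs_cast, abs_mul]
    rw [show (init q j I ε lam η).rank = q + 1 from rfl]
    simp only [bdNodes, List.mem_singleton, age, Nat.cast_one, one_mul]
    gcongr
    refine (h η hη _ (Finset.filter_subset _ _)).trans ?_
    gcongr
  | succ q ξ j I ε lam η ihξ =>
    obtain rfl : j = k := by simpa [weightIndex] using hk
    obtain ⟨hj, hξ, hη, hcoef, hw, -, hξq, hI⟩ := E.succ_mem_nodes hγ
    have hm : 0 < S.m j := by linarith [S.four_le_m hj]
    have hbd : (A.filter fun β => β.1 = succ q ξ j I ε lam η).card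
        + (A.filter fun β => β.1 ∈ ξ.bdNodes).card
        = (A.filter fun β => β.1 ∈ (succ q ξ j I ε lam η).bdNodes).card := by
      rw [← Finset.card_union_of_disjoint, ← Finset.filter_or]
      · simp only [bdNodes, List.mem_append, List.mem_singleton, or_comm]
      · refine Finset.disjoint_filter.2 fun β _ h1 h2 => ?_
        exact succ_notMem_bdNodes q ξ j I ε lam η (h1 ▸ h2)
    have hrank : (A.filter fun β => β.1.rank < ξ.rank).card
        + (A.filter fun β : E.nodes => E.idx β ∈ I).card
        ≤ (A.filter fun β => β.1.rank < q + 1).card := by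
      rw [← Finset.card_union_of_disjoint, ← Finset.filter_or]
      · refine Finset.card_le_card (Finset.monotone_filter_right _ fun β _ hβ => ?_)
        rcases hβ with hβ | hβ
        · exact (lt_of_lt_of_le hβ hξq).trans (Nat.lt_succ_self q)
        · exact Nat.lt_succ_of_le (hI β hβ).2
      · refine Finset.disjoint_filter.2 fun β _ h1 h2 => ?_
        exact absurd (hI β h2).1 (by omega)
    have hrank' : ((A.filter fun β => β.1.rank < ξ.rank).card : ℝ)
        + (A.filter fun β : E.nodes => E.idx β ∈ I).card
        ≤ (A.filter fun β => β.1.rank < q + 1).card := by exact_mod_cast hrank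
    have h1 := ihξ hξ hw
    have h2 : |ε * lam / S.m j * ∑ β ∈ A.filter (fun β : E.nodes => E.idx β ∈ I), dVal S E.idx β η|
        ≤ 1 / S.m j * (C + c * (A.filter fun β : E.nodes => E.idx β ∈ I).card) := by
      rw [abs_mul]
      exact mul_le_mul hcoef (h η hη _ (Finset.filter_subset _ _)) (abs_nonneg _) (by positivity)
    rw [sum_dVal_succ, ← hbd]
    refine (abs_add_le _ _).trans ?_
    rw [Nat.abs_cast]
    have h3 := (abs_add_le _ _).trans (add_le_add h1 h2)
    refine (add_le_add_right h3 _).trans ?_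
    rw [show (succ q ξ j I ε lam η).rank = q + 1 from rfl]
    simp only [age]
    push_cast
    have h4 : 1 / S.m j * (c * ((A.filter fun β => β.1.rank < ξ.rank).card
          + (A.filter fun β : E.nodes => E.idx β ∈ I).card))
        ≤ 1 / S.m j * (c * (A.filter fun β => β.1.rank < q + 1).card) := by
      gcongr
    linarith

/-- One step down the tree: a bound at all nodes, for all subsets of a set `A` without neighbours,
improves to a bound at the nodes of weight `1 / m_k`. -/
theorem abs_sum_dVal_le {A : Finset E.nodes}
    (hA : ∀ ξ ∈ A, ∀ ζ ∈ A, ξ ≠ ζ → ¬ E.Neighbours ξ ζ) {C c : ℝ} (hC : 0 ≤ C) (hc : 0 ≤ c)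
    (h : ∀ η ∈ E.nodes, ∀ B ⊆ A, |∑ β ∈ B, dVal S E.idx β η| ≤ C + c * B.card)
    (γ : Node) (hγ : γ ∈ E.nodes) {k : ℕ} (hk : γ.weightIndex = some k) :
    |∑ β ∈ A, dVal S E.idx β γ| ≤ 1 + 1 / S.m k * (S.n k * C + c * A.card) := by
  classical
  have hm : 0 < S.m k := by linarith [S.four_le_m (E.one_le_weightIndex hγ hk)]
  have h1 : ((A.filter fun β => β.1 ∈ γ.bdNodes).card : ℝ) ≤ 1 := by
    exact_mod_cast E.card_filter_bdNodes_le_one hA hγ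
  have h2 : (γ.age : ℝ) ≤ S.n k := by exact_mod_cast E.age_le hγ hk
  have h3 : ((A.filter fun β => β.1.rank < γ.rank).card : ℝ) ≤ A.card := by
    exact_mod_cast Finset.card_filter_le _ _
  refine (E.abs_sum_dVal_le_bdNodes hc h γ hγ hk).trans ?_
  gcongr

theorem abs_sum_dVal_le_two_mul_card (η : Node) (hη : η ∈ E.nodes) (B : Finset E.nodes) :
    |∑ β ∈ B, dVal S E.idx β η| ≤ 2 * B.card := by
  refine (Finset.abs_sum_le_sum_abs _ _).trans ?_
  refine (Finset.sum_le_card_nsmul B _ 2 fun β _ => E.abs_dVal_le β β.2 η hη).trans ?_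
  rw [nsmul_eq_mul, mul_comm]

theorem abs_sum_dVal_le_of_weight {A : Finset E.nodes}
    (hA : ∀ ξ ∈ A, ∀ ζ ∈ A, ξ ≠ ζ → ¬ E.Neighbours ξ ζ)
    (γ : Node) (hγ : γ ∈ E.nodes) {k : ℕ} (hk : γ.weightIndex = some k) :
    |∑ β ∈ A, dVal S E.idx β γ| ≤ 1 + 2 / S.m k * A.card := by
  have := E.abs_sum_dVal_le hA le_rfl zero_le_two
    (fun η hη B _ => by simpa using E.abs_sum_dVal_le_two_mul_card η hη B) γ hγ hk
  refine this.trans (le_of_eq ?_)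
  ring

theorem abs_sum_dVal_root_le (A : Finset E.nodes) :
    |∑ β ∈ A, dVal S E.idx β root| ≤ 1 := by
  classical
  have hcard : (A.filter fun β => root = β.1).card ≤ 1 := by
    rw [Finset.card_le_one]
    intro a ha b hb
    rw [Finset.mem_filter] at ha hb
    exact Subtype.ext (ha.2.symm.trans hb.2)
  have hsum : ∑ β ∈ A, dVal S E.idx β root = ((A.filter fun β => root = β.1).card : ℝ) := by
    simp only [dVal, Finset.sum_boole]
  rw [hsum, Nat.abs_cast]
  exact_mod_cast hcard

/-! ### Iteration along the tree -/

/-- The bound obtained by expanding the evaluation analyses of the nodes of weight index at most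
`i` down to depth `L`. The three terms come from the bd-parts, from the branches that meet a weight
of index larger than `i`, and from the branches that reach the depth `L`. -/
theorem abs_sum_dVal_le_of_depth {i : ℕ} (hi : 1 ≤ i) (L : ℕ) {A : Finset E.nodes}
    (hA : ∀ ξ ∈ A, ∀ ζ ∈ A, ξ ≠ ζ → ¬ E.Neighbours ξ ζ) (γ : Node) (hγ : γ ∈ E.nodes) :
    |∑ β ∈ A, dVal S E.idx β γ| ≤ ∑ s ∈ Finset.range (L + 1), ((S.n i : ℝ) / S.m i) ^ s
      + (2 / S.m (i + 1) + 2 / 4 ^ L) * A.card := by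
  have hR := S.one_le_ratio hi
  have hm := S.four_le_m (k := i + 1) (by omega)
  set R := (S.n i : ℝ) / S.m i
  induction L generalizing A γ with
  | zero =>
    have h1 := E.abs_sum_dVal_le_two_mul_card γ hγ A
    have h2 : 0 ≤ 2 / S.m (i + 1) * A.card := by positivity
    simp only [zero_add, Finset.range_one, Finset.sum_singleton, pow_zero, div_one]
    linarith
  | succ L ih =>
    have hgeom : ∑ s ∈ Finset.range (L + 2), R ^ s
        = 1 + R * ∑ s ∈ Finset.range (L + 1), R ^ s := by
      rw [Finset.sum_range_succ', Finset.mul_sum, pow_zero, add_comm]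
      simp only [pow_succ']
    have hG : 0 ≤ ∑ s ∈ Finset.range (L + 1), R ^ s := by positivity
    rw [hgeom]
    have hRG : 0 ≤ R * ∑ s ∈ Finset.range (L + 1), R ^ s := by positivity
    cases hw : γ.weightIndex with
    | none =>
      have hroot : γ = root := by cases γ <;> simp_all [weightIndex]
      subst hroot
      have h1 := E.abs_sum_dVal_root_le A
      have h2 : 0 ≤ (2 / S.m (i + 1) + 2 / 4 ^ (L + 1)) * (A.card : ℝ) := by positivity
      linarith
    | some k =>
      have hk := E.one_le_weightIndex hγ hw
      rcases le_or_gt (i + 1) k with hik | hik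
      · have h1 := E.abs_sum_dVal_le_of_weight hA γ hγ hw
        have h2 := S.m_mono (by omega) hik
        have h3 : 2 / S.m k * A.card ≤ (2 / S.m (i + 1) + 2 / 4 ^ (L + 1)) * (A.card : ℝ) := by
          gcongr
          refine (div_le_div_of_nonneg_left zero_le_two (by linarith) h2).trans ?_
          have : (0 : ℝ) ≤ 2 / 4 ^ (L + 1) := by positivity
          linarith
        linarith
      · have hmk := S.four_le_m hk
        have h1 := E.abs_sum_dVal_le hA hG (c := 2 / S.m (i + 1) + 2 / 4 ^ L) (by positivity)
          (fun η hη B hB => ih (fun ξ hξ ζ hζ => hA ξ (hB hξ) ζ (hB hζ)) η hη) γ hγ hw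
        have h2 : (S.n k : ℝ) / S.m k ≤ R := S.ratio_mono hk (by omega)
        have h3 : 1 / S.m k ≤ 1 / 4 := one_div_le_one_div_of_le (by norm_num) hmk
        have h4 : 1 / S.m k * ((2 / S.m (i + 1) + 2 / 4 ^ L) * A.card)
            ≤ (2 / S.m (i + 1) + 2 / 4 ^ (L + 1)) * (A.card : ℝ) := by
          calc 1 / S.m k * ((2 / S.m (i + 1) + 2 / 4 ^ L) * A.card)
              ≤ 1 / 4 * ((2 / S.m (i + 1) + 2 / 4 ^ L) * A.card) := by gcongr
            _ = (1 / 4 * (2 / S.m (i + 1)) + 2 / 4 ^ (L + 1)) * A.card := by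
              rw [pow_succ]; field_simp
            _ ≤ (2 / S.m (i + 1) + 2 / 4 ^ (L + 1)) * (A.card : ℝ) := by
              gcongr
              have : 0 ≤ 2 / S.m (i + 1) := by positivity
              linarith
        calc _ ≤ _ := h1
          _ = 1 + S.n k / S.m k * ∑ s ∈ Finset.range (L + 1), R ^ s
              + 1 / S.m k * ((2 / S.m (i + 1) + 2 / 4 ^ L) * A.card) := by ring
          _ ≤ 1 + R * ∑ s ∈ Finset.range (L + 1), R ^ s
              + (2 / S.m (i + 1) + 2 / 4 ^ (L + 1)) * A.card := by gcongr

/-- At a node of weight index less than `i + 1`, the sum over at most `n_{i+1}` elements is at most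
`6 n_{i+1} / (m_k m_{i+1})`. -/
theorem abs_sum_dVal_le_of_weight_lt {i : ℕ} (hi : 1 ≤ i)
    (h2 : i = 1 → ((S.l 2 : ℝ) + 1) / (S.n 2 : ℝ) ≤ 2 / (S.m 1 * S.m 2)) {A : Finset E.nodes}
    (hA : ∀ ξ ∈ A, ∀ ζ ∈ A, ξ ≠ ζ → ¬ E.Neighbours ξ ζ) (hcard : A.card ≤ S.n (i + 1))
    (γ : Node) (hγ : γ ∈ E.nodes) {k : ℕ} (hk : γ.weightIndex = some k) (hki : k ≤ i) :
    |∑ β ∈ A, dVal S E.idx β γ| ≤ S.n (i + 1) * (6 / (S.m k * S.m (i + 1))) := by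
  have hk1 := E.one_le_weightIndex hγ hk
  have hmk := S.four_le_m hk1
  have hmi := S.four_le_m hi
  have hmi' := S.four_le_m (k := i + 1) (by omega)
  have hmki := S.m_mono hk1 hki
  have hratio := S.ratio_mono hk1 hki
  have hR := S.one_le_ratio hi
  have hgeo := S.geom_sum_ratio_le hi h2
  have hpow := S.m_mul_le i hi
  rw [S.m_one] at hpow
  -- the first step down the tree costs one unit of depth, and it gains the factor `1 / m_k`
  obtain ⟨L, hL⟩ : ∃ L, S.l (i + 1) = L + 1 :=
    ⟨S.l (i + 1) - 1, by have := S.two_le_l (k := i + 1) (by omega); omega⟩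
  rw [hL] at hgeo hpow
  set R := (S.n i : ℝ) / S.m i
  have hgeom : ∑ s ∈ Finset.range (L + 1 + 1), R ^ s
      = 1 + R * ∑ s ∈ Finset.range (L + 1), R ^ s := by
    rw [Finset.sum_range_succ', Finset.mul_sum, pow_zero, add_comm]
    simp only [pow_succ']
  have hG : 0 ≤ ∑ s ∈ Finset.range (L + 1), R ^ s := by positivity
  have hc : 2 / S.m (i + 1) + 2 / 4 ^ L ≤ 4 / S.m (i + 1) := by
    have h4 : S.m (i + 1) ≤ 4 ^ L := by
      rw [pow_succ] at hpow
      nlinarith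
    have : (2 : ℝ) / 4 ^ L ≤ 2 / S.m (i + 1) :=
      div_le_div_of_nonneg_left zero_le_two (by linarith) h4
    have h6 : 4 / S.m (i + 1) = 2 / S.m (i + 1) + 2 / S.m (i + 1) := by ring
    linarith
  have h1 := E.abs_sum_dVal_le hA hG (c := 4 / S.m (i + 1)) (by positivity)
    (fun η hη B hB => (E.abs_sum_dVal_le_of_depth hi L
      (fun ξ hξ ζ hζ => hA ξ (hB hξ) ζ (hB hζ)) η hη).trans (by gcongr)) γ hγ hk
  have hcard' : (A.card : ℝ) ≤ S.n (i + 1) := by exact_mod_cast hcard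
  calc |∑ β ∈ A, dVal S E.idx β γ| ≤ _ := h1
    _ = 1 + S.n k / S.m k * ∑ s ∈ Finset.range (L + 1), R ^ s
        + 1 / S.m k * (4 / S.m (i + 1) * A.card) := by ring
    _ ≤ 1 + R * ∑ s ∈ Finset.range (L + 1), R ^ s
        + 1 / S.m k * (4 / S.m (i + 1) * S.n (i + 1)) := by gcongr
    _ ≤ 2 * ((S.n (i + 1) : ℝ) / (S.m i * S.m (i + 1)))
        + 1 / S.m k * (4 / S.m (i + 1) * S.n (i + 1)) := by
      rw [← hgeom]; gcongr
    _ ≤ 2 * ((S.n (i + 1) : ℝ) / (S.m k * S.m (i + 1)))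
        + 1 / S.m k * (4 / S.m (i + 1) * S.n (i + 1)) := by gcongr
    _ = S.n (i + 1) * (6 / (S.m k * S.m (i + 1))) := by field_simp; ring

theorem smul_sum_d_apply (F : Finset E.nodes) (t : ℝ) (γ : E.nodes) :
    (t • ∑ ξ ∈ F, E.d ξ) γ = t * ∑ ξ ∈ F, dVal S E.idx ξ γ := by
  rw [lp.coeFn_smul, Pi.smul_apply, smul_eq_mul, lp.coeFn_sum, Finset.sum_apply]
  rfl

end Enumeration

end BDSpace

theorem mainTheorem8 (S : BDSpace.Params) (E : BDSpace.Enumeration S) (j : ℕ) (hj : 1 ≤ j)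
    (F : Finset E.nodes) (hF : ∀ ξ ∈ F, ∀ ζ ∈ F, ξ ≠ ζ → ¬ E.Neighbours ξ ζ)
    (hcard : F.card ≤ S.n j)
    (x : lp (fun _ : E.nodes => ℝ) ∞) (hx : x = ((S.n j : ℝ)⁻¹) • ∑ ξ ∈ F, E.d ξ) :
    (∀ (γ : E.nodes) (k : ℕ), γ.1.weightIndex = some k → j ≤ k →
      |x γ| ≤ 1 / (S.n j : ℝ) + 2 / S.m k) ∧
    ((j = 2 → ((S.l 2 : ℝ) + 1) / (S.n 2 : ℝ) ≤ 2 / (S.m 1 * S.m 2)) →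
      (∀ (γ : E.nodes) (k : ℕ), γ.1.weightIndex = some k → k < j →
        |x γ| ≤ 7 / (S.m k * S.m j)) ∧
      ‖x‖ ≤ 7 / S.m j) := by
  have hn : (0 : ℝ) < S.n j := by
    have := S.four_le_n hj
    positivity
  have hm := S.four_le_m hj
  have hcard' : (F.card : ℝ) ≤ S.n j := by exact_mod_cast hcard
  have habs : ∀ (γ : E.nodes) (b : ℝ), |∑ ξ ∈ F, BDSpace.dVal S E.idx ξ γ| ≤ S.n j * b →
      |x γ| ≤ b := by
    intro γ b h
    rw [hx, E.smul_sum_d_apply, abs_mul, abs_inv, Nat.abs_cast, inv_mul_le_iff₀ hn]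
    exact h
  have hlarge : ∀ (γ : E.nodes) (k : ℕ), γ.1.weightIndex = some k →
      |x γ| ≤ 1 / (S.n j : ℝ) + 2 / S.m k := by
    intro γ k hk
    have hmk := S.four_le_m (E.one_le_weightIndex γ.2 hk)
    refine habs γ _ ((E.abs_sum_dVal_le_of_weight hF γ γ.2 hk).trans ?_)
    rw [mul_add, mul_one_div_cancel hn.ne', mul_comm (S.n j : ℝ)]
    gcongr
  refine ⟨fun γ k hk _ => hlarge γ k hk, fun h2 => ?_⟩
  have hsmall : ∀ (γ : E.nodes) (k : ℕ), γ.1.weightIndex = some k → k < j →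
      |x γ| ≤ 7 / (S.m k * S.m j) := by
    intro γ k hk hkj
    have hk1 := E.one_le_weightIndex γ.2 hk
    have hmk := S.four_le_m hk1
    obtain ⟨i, rfl⟩ : ∃ i, j = i + 1 := ⟨j - 1, by omega⟩
    refine habs γ _ ((E.abs_sum_dVal_le_of_weight_lt (by omega) (fun h => h2 (by omega)) hF hcard
      γ γ.2 hk (by omega)).trans ?_)
    gcongr
    norm_num
  refine ⟨hsmall, lp.norm_le_of_forall_le (by positivity) fun γ => ?_⟩
  rw [Real.norm_eq_abs]
  have hmn : 1 / (S.n j : ℝ) ≤ 1 / S.m j :=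
    one_div_le_one_div_of_le (by linarith) (S.m_le_n hj)
  have hm0 : 0 ≤ 1 / S.m j := by positivity
  have h7 : 7 / S.m j = 7 * (1 / S.m j) := by ring
  cases hw : γ.1.weightIndex with
  | none =>
    have hroot : γ.1 = BDSpace.Node.root := by
      cases hγ : γ.1 <;> simp_all [BDSpace.Node.weightIndex]
    have h1 : |x γ| ≤ 1 / (S.n j : ℝ) := by
      refine habs γ _ ?_
      rw [mul_one_div_cancel hn.ne', hroot]
      exact E.abs_sum_dVal_root_le F
    linarith
  | some k =>
    rcases lt_or_ge k j with hkj | hkj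
    · have hmk := S.four_le_m (E.one_le_weightIndex γ.2 hw)
      refine (hsmall γ k hw hkj).trans ?_
      exact div_le_div_of_nonneg_left (by norm_num) (by linarith) (by nlinarith)
    · have h1 := hlarge γ k hw
      have h3 : 2 / S.m k ≤ 2 / S.m j :=
        div_le_div_of_nonneg_left zero_le_two (by linarith) (S.m_mono hj hkj)
      have h4 : 2 / S.m j = 2 * (1 / S.m j) := by ring
      linarith
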